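/- Let $\mathcal H$ and $\mathcal G$ be real Hilbert spaces. For $\mathcal E\in\{\mathcal H,\mathcal G\}$, let $\Gamma_0(\mathcal E)$ be the class of lower semicontinuous convex functions $h\colon\mathcal E\to\left]-\infty,+\infty\right]$ with $\operatorname{dom}h=\{x : h(x)<+\infty\}\neq\varnothing$. The conjugate of $h$ is $h^*(u)=\sup_{x}(\langle x,u\rangle-h(x))$ and its subdifferential is $\partial h(x)=\{u : \langle y-x,u\rangle+h(x)\le h(y)\text{ for all }y\}$. For a set-valued operator $M$, write $\operatorname{zer}M=\{x : 0\in Mx\}$ and $\operatorname{ran}M=\{u : u\in Mx\text{ for some }x\}$. $\operatorname{Argmin}\varphi$ is the set of global minimizers of $\varphi$, that is, the points where $\varphi$ attains its infimum with a finite value. For a convex set $C$, $\operatorname{sri}C$ is the set of $x\in C$ such that the cone generated by $C-x$ is a closed vector subspace, and $\iota_C$ equals $0$ on $C$ and $+\infty$ elsewhere. **Proposition 4.1.** Let $f\in\Gamma_0(\mathcal H)$, let $g\in\Gamma_0(\mathcal G)$, let $L\colon\mathcal H\to\mathcal G$ be a bounded linear operator with adjoint $L^*$, let $z\in\mathcal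 H$, and let $r\in\mathcal G$. Then the following hold. 1. $\operatorname{zer}\big(-z+\partial f+L^*\circ(\partial g)\circ(L\cdot-r)\big)\subset\operatorname{Argmin}\big(f-\langle\cdot,z\rangle+g\circ(L\cdot-r)\big)$. 2. $\operatorname{zer}\big(r-L\circ(\partial f^*)\circ(z-L^*\cdot)+\partial g^*\big)\subset\operatorname{Argmin}\big(f^*(z-L^*\cdot)+g^*+\langle r,\cdot\rangle\big)$. 3. Suppose that one of the following is satisfied. - (a) $\operatorname{Argmin}\big(f+g\circ(L\cdot-r)-\langle\cdot,z\rangle\big)\neq\varnothing$ and $r\in\operatorname{sri}\big(L(\operatorname{dom}f)-\operatorname{dom}g\big)$. - (b) $\operatorname{Argmin}\big(f+g\circ(L\cdot-r)-\langle\cdot,z\rangle\big)\subset\operatorname{Argmin}\big(f-\langle\cdot,z\rangle\big)\cap\operatorname{Argmin}\big(g\circ(L\cdot-r)\big)\neq\varnothing$ and $r\in\operatorname{sri}\big(\operatorname{ran}L-\operatorname{dom}g\big)$. - (c) $f=\iota_C$, $g=\iota_D$ and $z=0$, where $C\subset\mathcal H$ and $D\subset\mathcal G$ are closed convex sets such that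 $C\cap L^{-1}(r+D)\neq\varnothing$ and $r\in\operatorname{sri}(\operatorname{ran}L-D)$. Then $z\in\operatorname{ran}\big(\partial f+L^*\circ(\partial g)\circ(L\cdot-r)\big)$. -/

import Mathlib

open scoped Pointwise

namespace ConvexHilbert

noncomputable section

/-- The effective domain of an extended-real-valued function. -/
def effDom {E : Type*} (f : E → EReal) : Set E := {x | f x < ⊤}

/-- The class `Γ₀(E)`: lower semicontinuous convex functions `E → ]-∞, +∞]` with nonempty domain.
Convexity is convexity of the epigraph. -/
structure Gamma0 {E : Type*} [NormedAddCommGroup E] [InnerProductSpace ℝ E]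
    (f : E → EReal) : Prop where
  ne_bot : ∀ x, f x ≠ ⊥
  dom_nonempty : (effDom f).Nonempty
  lsc : LowerSemicontinuous f
  convex_epi : Convex ℝ {p : E × ℝ | f p.1 ≤ (p.2 : EReal)}

/-- The Fenchel conjugate `f* : u ↦ sup_x (⟨x, u⟩ - f x)`. -/
def conj {E : Type*} [NormedAddCommGroup E] [InnerProductSpace ℝ E]
    (f : E → EReal) (u : E) : EReal :=
  ⨆ x : E, (((inner ℝ x u : ℝ) : EReal) - f x)

/-- The subdifferential `∂f : x ↦ {u | ∀ y, ⟨y - x, u⟩ + f x ≤ f y}`. -/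
def subdiff {E : Type*} [NormedAddCommGroup E] [InnerProductSpace ℝ E]
    (f : E → EReal) (x : E) : Set E :=
  {u | ∀ y : E, ((inner ℝ (y - x) u : ℝ) : EReal) + f x ≤ f y}

/-- The set of zeros of a set-valued operator. -/
def zer {E F : Type*} [Zero F] (M : E → Set F) : Set E := {x | 0 ∈ M x}

/-- The range of a set-valued operator. -/
def ran {E F : Type*} (M : E → Set F) : Set F := {u | ∃ x, u ∈ M x}

/-- The set of (global) minimizers of `φ : E → ]-∞, +∞]`: the points at which `φ` attains its
infimum, this minimal value being finite. A function that is identically `+∞` has no minimizer. -/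
def Argmin {E : Type*} (φ : E → EReal) : Set E := {x | φ x < ⊤ ∧ ∀ y, φ x ≤ φ y}

/-- The strong relative interior of `C`: the points `x ∈ C` such that the cone generated by
`C - x` is a closed vector subspace. -/
def sri {E : Type*} [NormedAddCommGroup E] [InnerProductSpace ℝ E] (C : Set E) : Set E :=
  {x | x ∈ C ∧ ∃ V : Submodule ℝ E, IsClosed (V : Set E) ∧
    {w : E | ∃ t : ℝ, 0 < t ∧ ∃ y ∈ C, w = t • (y - x)} = (V : Set E)}

open Classical in
/-- The indicator function of `C`: `0` on `C` and `+∞` elsewhere. -/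
def indicatorFn {E : Type*} (C : Set E) (x : E) : EReal := if x ∈ C then 0 else ⊤

end

end ConvexHilbert

/-! The two inclusions are Fermat's rule: adding the subgradient inequalities makes the inner
products cancel. In the dual one, finiteness of the minimal value also needs proper conjugates,
hence a continuous affine minorant (`Gamma0.effDom_conj_nonempty`).

Solvability under (a) is Lagrangian duality at a minimizer `x`. Shift the epigraphs of `f` and `g`
to the points over `x` and `L x - r`, and minimize the linear increment of the objective over their
product subject to `L h = k`. The `sri` condition says that the constraint map absorbs a closed
subspace `V`. Baire's theorem and successive approximation (`exists_ball_subset_image_of_absorbing`)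
turn this into a ball in the image of a bounded part, so the value function is bounded above near
`0`. Hahn–Banach then gives a multiplier (`exists_multiplier_of_absorbing`), which splits into a
subgradient of `f` and one of `g`.

Case (b) applies this with `f` replaced by `0`; in case (c) zero subgradients suffice. -/

namespace ConvexHilbert

/-! ### Open mapping on convex sets and Lagrange multipliers -/

section OpenMapping

variable {X Y : Type*} [NormedAddCommGroup X] [NormedSpace ℝ X] [CompleteSpace X]
  [NormedAddCommGroup Y] [NormedSpace ℝ Y]

/-- If the closure of the image of a bounded closed convex set under a continuous linear map
contains a ball around the origin, then the image itself contains the ball of half the radius. -/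
theorem ball_half_subset_image_of_subset_closure {K : Set X} (hKc : IsClosed K)
    (hKx : Convex ℝ K) {R : ℝ} (hKb : ∀ x ∈ K, ‖x‖ ≤ R) (T : X →L[ℝ] Y) {δ : ℝ} (hδ : 0 < δ)
    (hcl : Metric.ball (0 : Y) δ ⊆ closure (T '' K)) :
    Metric.ball (0 : Y) (δ / 2) ⊆ T '' K := by
  have step : ∀ y : Y, ‖y‖ < δ / 2 → ∃ k ∈ K, ‖(2 : ℝ) • y - T k‖ < δ / 2 := by
    intro y hy
    have h2 : (2 : ℝ) • y ∈ Metric.ball (0 : Y) δ := by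
      rw [mem_ball_zero_iff, norm_smul]; norm_num; linarith
    obtain ⟨_, ⟨k, hk, rfl⟩, hd⟩ := Metric.mem_closure_iff.1 (hcl h2) (δ / 2) (by linarith)
    exact ⟨k, hk, by rwa [dist_eq_norm] at hd⟩
  choose! k hkK hk using step
  intro y hy
  rw [mem_ball_zero_iff] at hy
  -- `e n` is the error after `n` approximations, rescaled by `2 ^ n` so that it stays in the ball
  -- of radius `δ / 2`.
  let e : ℕ → Y := fun n => Nat.rec y (fun _ z => (2 : ℝ) • z - T (k z)) n
  have e_succ : ∀ n, e (n + 1) = (2 : ℝ) • e n - T (k (e n)) := fun n => rfl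
  have he : ∀ n, ‖e n‖ < δ / 2 := by
    intro n
    induction n with
    | zero => exact hy
    | succ n ih => rw [e_succ]; exact hk _ ih
  let x : ℕ → X := fun n => k (e n)
  have hx : ∀ n, x n ∈ K := fun n => hkK _ (he n)
  let S : ℕ → X := fun n => ∑ i ∈ Finset.range n, ((1 / 2 : ℝ) ^ (i + 1)) • x i
  have S_succ : ∀ n, S (n + 1) = S n + ((1 / 2 : ℝ) ^ (n + 1)) • x n :=
    fun n => Finset.sum_range_succ _ _
  have hTS : ∀ n, T (S n) = y - ((1 / 2 : ℝ) ^ n) • e n := by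
    intro n
    induction n with
    | zero => simp [S, e]
    | succ n ih =>
      rw [S_succ, map_add, ih, map_smul, e_succ, smul_sub, smul_smul, pow_succ]
      have : (1 / 2 : ℝ) ^ n * (1 / 2) * 2 = (1 / 2) ^ n := by ring
      rw [this]
      abel
  have hsum : Summable fun i => ((1 / 2 : ℝ) ^ (i + 1)) • x i := by
    refine Summable.of_norm_bounded (g := fun i => (1 / 2 : ℝ) ^ i * R)
      (summable_geometric_two.mul_right R) fun i => ?_
    have hR : 0 ≤ R := (norm_nonneg _).trans (hKb _ (hx i))
    rw [norm_smul, Real.norm_of_nonneg (by positivity)]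
    refine mul_le_mul ?_ (hKb _ (hx i)) (norm_nonneg _) (by positivity)
    exact pow_le_pow_of_le_one (by norm_num) (by norm_num) (Nat.le_succ i)
  obtain ⟨s, hs⟩ := hsum
  have hSs : Filter.Tendsto S Filter.atTop (nhds s) := hs.tendsto_sum_nat
  have hpow : Filter.Tendsto (fun n : ℕ => (1 / 2 : ℝ) ^ n) Filter.atTop (nhds 0) :=
    tendsto_pow_atTop_nhds_zero_of_lt_one (by norm_num) (by norm_num)
  -- The weights in `S n` add up to `1 - (1 / 2) ^ n`; putting the missing mass on a point of `K`
  -- completes a convex combination, so `0 ∈ K` is not needed.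
  have hSK : ∀ n, ∀ c ∈ K, S n + ((1 / 2 : ℝ) ^ n) • c ∈ K := by
    intro n
    induction n with
    | zero => intro c hc; simpa [S] using hc
    | succ n ih =>
      intro c hc
      have hm : (1 / 2 : ℝ) • x n + (1 / 2 : ℝ) • c ∈ K :=
        hKx (hx n) hc (by norm_num) (by norm_num) (by norm_num)
      have := ih _ hm
      rw [S_succ]
      convert this using 1
      rw [smul_add, smul_smul, smul_smul, pow_succ]
      abel
  have hsK : s ∈ K := by
    refine hKc.mem_of_tendsto (f := fun n => S n + ((1 / 2 : ℝ) ^ n) • x 0) (b := Filter.atTop) ?_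
      (Filter.Eventually.of_forall fun n => hSK n _ (hx 0))
    simpa using hSs.add (hpow.smul_const (x 0))
  refine ⟨s, hsK, ?_⟩
  have h1 : Filter.Tendsto (fun n => T (S n)) Filter.atTop (nhds (T s)) :=
    (T.continuous.tendsto s).comp hSs
  have h2 : Filter.Tendsto (fun n => T (S n)) Filter.atTop (nhds y) := by
    have h0 : Filter.Tendsto (fun n => ((1 / 2 : ℝ) ^ n) • e n) Filter.atTop (nhds 0) := by
      refine squeeze_zero_norm (a := fun n => (1 / 2 : ℝ) ^ n * (δ / 2)) (fun n => ?_)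
        (by simpa using hpow.mul_const (δ / 2))
      rw [norm_smul, Real.norm_of_nonneg (by positivity)]
      exact mul_le_mul_of_nonneg_left (he n).le (by positivity)
    simp only [hTS]
    simpa using tendsto_const_nhds.sub h0
  exact tendsto_nhds_unique h1 h2

/-- A version of the Robinson–Ursescu theorem: if the image of a closed convex set under a
continuous linear map is absorbing, the image of some bounded part is a neighbourhood of `0`. -/
theorem exists_ball_subset_image_of_absorbing [CompleteSpace Y] {E : Set X} (hEc : IsClosed E)
    (hEx : Convex ℝ E) (T : X →L[ℝ] Y)
    (habs : ∀ y : Y, ∃ t : ℝ, 0 < t ∧ ∃ e ∈ E, y = t • T e) :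
    ∃ δ > 0, ∃ R : ℝ, Metric.ball (0 : Y) δ ⊆ T '' (E ∩ Metric.closedBall 0 R) := by
  let K : ℕ → Set X := fun n => E ∩ Metric.closedBall 0 (n : ℝ)
  have hKx : ∀ n, Convex ℝ (K n) := fun n => hEx.inter (convex_closedBall _ _)
  have hKmono : Monotone K := fun m n h =>
    Set.inter_subset_inter_right _ (Metric.closedBall_subset_closedBall (by exact_mod_cast h))
  obtain ⟨t₀, ht₀, e₀, he₀, h0⟩ := habs 0
  have hTe₀ : T e₀ = 0 := by
    rcases smul_eq_zero.1 h0.symm with h | h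
    · exact absurd h ht₀.ne'
    · exact h
  have cover : ∀ y : Y, ∃ n : ℕ, 0 < n ∧ ∃ k ∈ K n, y = (n : ℝ) • T k := by
    intro y
    obtain ⟨t, ht, e, he, rfl⟩ := habs y
    obtain ⟨n, hn⟩ := exists_nat_gt (max t (max ‖e‖ ‖e₀‖))
    obtain ⟨hn1, hn2⟩ := max_lt_iff.1 hn
    obtain ⟨hn2, hn3⟩ := max_lt_iff.1 hn2
    have hnpos : (0 : ℝ) < n := ht.trans hn1
    -- Since `T e₀ = 0`, mixing in `e₀` trades the real factor `t` for the integer `n`.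
    refine ⟨n, by exact_mod_cast hnpos, (t / n) • e + (1 - t / n) • e₀, ?_, ?_⟩
    · refine hKx n ⟨he, ?_⟩ ⟨he₀, ?_⟩ (by positivity) ?_ (by ring)
      · simpa using hn2.le
      · simpa using hn3.le
      · rw [sub_nonneg, div_le_one hnpos]; exact hn1.le
    · rw [map_add, map_smul, map_smul, hTe₀, smul_zero, add_zero, smul_smul]
      congr 1
      field_simp
  let C : ℕ → Set Y := fun n => closure (T '' K n)
  have hCx : ∀ n, Convex ℝ (C n) := fun n => ((hKx n).is_linear_image T.isLinear).closure
  have hCmono : Monotone C := fun m n h => closure_mono (Set.image_mono (hKmono h))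
  -- Baire category; the shift to `n + 1` keeps the scaling factor nonzero.
  obtain ⟨n, y₀, hy₀⟩ : ∃ n, (interior (C n)).Nonempty := by
    have hcl : ∀ n : ℕ, IsClosed (((n : ℝ) + 1) • C (n + 1)) := fun n =>
      isClosed_closure.smul_of_ne_zero (by positivity)
    obtain ⟨n, hn⟩ := nonempty_interior_of_iUnion_of_closed hcl (by
      refine Set.eq_univ_of_forall fun y => ?_
      obtain ⟨n, hn, k, hk, rfl⟩ := cover y
      obtain ⟨m, rfl⟩ := Nat.exists_eq_succ_of_ne_zero hn.ne'
      refine Set.mem_iUnion.2 ⟨m, ?_⟩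
      rw [Nat.succ_eq_add_one, Nat.cast_add, Nat.cast_one]
      exact Set.smul_mem_smul_set (subset_closure ⟨k, hk, rfl⟩))
    refine ⟨n + 1, ?_⟩
    rw [interior_smul₀ (by positivity)] at hn
    exact Set.smul_set_nonempty.1 hn
  obtain ⟨m, hm, k, hk, hy⟩ := cover (-y₀)
  have hm' : (0 : ℝ) < m := by exact_mod_cast hm
  have h0int : (0 : Y) ∈ interior (C (max n m)) := by
    have h1 : y₀ ∈ interior (C (max n m)) := interior_mono (hCmono (le_max_left n m)) hy₀
    have h2 : T k ∈ C (max n m) := hCmono (le_max_right n m) (subset_closure ⟨k, hk, rfl⟩)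
    -- As `-y₀ = m • T k`, these weights make the combination of `y₀` and `T k` vanish.
    have := (hCx (max n m)).combo_interior_self_mem_interior h1 h2
      (a := 1 / (m + 1)) (b := m / (m + 1)) (by positivity) (by positivity) (by field_simp; ring)
    convert this using 1
    have hy' : y₀ = -((m : ℝ) • T k) := by rw [← hy, neg_neg]
    rw [hy', smul_neg, smul_smul]
    rw [show (1 / ((m : ℝ) + 1)) * m = m / (m + 1) by ring]
    abel
  obtain ⟨δ, hδ, hball⟩ := Metric.isOpen_iff.1 isOpen_interior 0 h0int
  refine ⟨δ / 2, by positivity, ((max n m : ℕ) : ℝ), ?_⟩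
  exact ball_half_subset_image_of_subset_closure (hEc.inter Metric.isClosed_closedBall)
    (hKx (max n m)) (R := ((max n m : ℕ) : ℝ)) (fun x hx => by simpa using hx.2) T hδ
    (hball.trans interior_subset)

/-- Lagrange multipliers for minimizing a linear functional over a closed convex set subject to
a linear constraint, under an absorption (core) qualification. -/
theorem exists_multiplier_of_absorbing [CompleteSpace Y] {E : Set X} (hEc : IsClosed E)
    (hEx : Convex ℝ E) (T : X →L[ℝ] Y) (φ : X →L[ℝ] ℝ)
    (habs : ∀ y : Y, ∃ t : ℝ, 0 < t ∧ ∃ e ∈ E, y = t • T e)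
    (hmin : ∀ e ∈ E, T e = 0 → 0 ≤ φ e) :
    ∃ l : Y →L[ℝ] ℝ, ∀ e ∈ E, l (T e) ≤ φ e := by
  obtain ⟨δ, hδ, R, hball⟩ := exists_ball_subset_image_of_absorbing hEc hEx T habs
  -- The strict epigraph of the value function `y ↦ inf {φ e | e ∈ E, T e = y}`; its supporting
  -- hyperplane at the origin yields the multiplier.
  let Q : Set (Y × ℝ) := {q | ∃ e ∈ E, T e = q.1 ∧ φ e < q.2}
  have hQx : Convex ℝ Q := by
    rintro ⟨_, s⟩ ⟨e, he, rfl, hs⟩ ⟨_, s'⟩ ⟨e', he', rfl, hs'⟩ a b ha hb hab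
    refine ⟨a • e + b • e', hEx he he' ha hb hab, by simp, ?_⟩
    simp only [map_add, map_smul, smul_eq_mul, Prod.mk_add_mk, Prod.smul_mk]
    simp only at hs hs'
    rcases ha.eq_or_lt with rfl | ha
    · have : b = 1 := by linarith
      subst this; linarith
    · nlinarith
  have hO : Metric.ball (0 : Y) δ ×ˢ Set.Ioi (‖φ‖ * R) ⊆ interior Q := by
    refine interior_maximal ?_ (Metric.isOpen_ball.prod isOpen_Ioi)
    rintro ⟨y, s⟩ ⟨hy, hs⟩
    obtain ⟨e, ⟨he, heR⟩, rfl⟩ := hball hy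
    refine ⟨e, he, rfl, ?_⟩
    have h1 : φ e ≤ ‖φ‖ * ‖e‖ := (le_abs_self _).trans (φ.le_opNorm e)
    have h2 : ‖φ‖ * ‖e‖ ≤ ‖φ‖ * R :=
      mul_le_mul_of_nonneg_left (by simpa using heR) (norm_nonneg _)
    exact (h1.trans h2).trans_lt hs
  have h0Q : (0 : Y × ℝ) ∉ interior Q := fun h => by
    obtain ⟨e, he, hTe, hφ⟩ := interior_subset h
    exact absurd (hmin e he hTe) (not_le.2 hφ)
  obtain ⟨F, hF⟩ := geometric_hahn_banach_open_point hQx.interior isOpen_interior h0Q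
  rw [map_zero] at hF
  have hne : (interior Q).Nonempty :=
    ⟨(0, ‖φ‖ * R + 1), hO ⟨Metric.mem_ball_self hδ, by simp⟩⟩
  have hFQ : ∀ q ∈ Q, F q ≤ 0 := by
    intro q hq
    have hq' : q ∈ closure (interior Q) := by
      rw [hQx.closure_interior_eq_closure_of_nonempty_interior hne]; exact subset_closure hq
    exact closure_minimal (fun p hp => (hF p hp).le)
      (isClosed_le F.continuous continuous_const) hq'
  let m : Y →L[ℝ] ℝ := F.comp (ContinuousLinearMap.inl ℝ Y ℝ)
  let c : ℝ := F (0, 1)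
  have hFd : ∀ y s, F (y, s) = m y + s * c := by
    intro y s
    have : ((y, s) : Y × ℝ) = (y, 0) + s • ((0, 1) : Y × ℝ) := by simp
    rw [this, map_add, map_smul, smul_eq_mul]
    rfl
  -- The hyperplane is not vertical, because `Q` has interior points above the origin.
  have hc : c < 0 := by
    have h1 := hF _ (hO (show ((0 : Y), |‖φ‖ * R| + 1) ∈ _ from
      ⟨Metric.mem_ball_self hδ, by
        simp only [Set.mem_Ioi]; linarith [le_abs_self (‖φ‖ * R)]⟩))
    rw [hFd, map_zero, zero_add] at h1
    have := abs_nonneg (‖φ‖ * R)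
    nlinarith
  refine ⟨(-c)⁻¹ • m, fun e he => ?_⟩
  have hle : m (T e) + φ e * c ≤ 0 := by
    refine le_of_forall_pos_le_add fun ε hε => ?_
    have := hFQ (T e, φ e + ε / (-c)) ⟨e, he, rfl, by
      have : 0 < ε / (-c) := div_pos hε (by linarith)
      simpa using this⟩
    rw [hFd, add_mul, div_mul_eq_mul_div, mul_div_assoc, div_neg, div_self hc.ne] at this
    linarith
  have hc' : 0 < -c := by linarith
  rw [smul_apply, smul_eq_mul, inv_mul_le_iff₀ hc']
  linarith

end OpenMapping
end ConvexHilbert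

namespace ConvexHilbert

/-! ### Subgradients, conjugates and affine minorants -/

section Functions

variable {E : Type*} [NormedAddCommGroup E] [InnerProductSpace ℝ E] {f : E → EReal}

theorem exists_coe_eq_of_lt_top {a : EReal} (hb : a ≠ ⊥) (ht : a < ⊤) : ∃ t : ℝ, a = t :=
  ⟨a.toReal, (EReal.coe_toReal ht.ne hb).symm⟩

theorem Gamma0.isClosed_epi (hf : Gamma0 f) :
    IsClosed {p : E × ℝ | f p.1 ≤ (p.2 : EReal)} := by
  have h : Continuous fun p : E × ℝ => (p.1, (p.2 : EReal)) :=
    continuous_fst.prodMk (continuous_coe_real_ereal.comp continuous_snd)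
  exact hf.lsc.isClosed_epigraph.preimage h

/-- If `f x = ⊤`, the subgradient inequality forces `f = ⊤` everywhere. -/
theorem lt_top_of_mem_subdiff {x u : E} (hdom : (effDom f).Nonempty) (hu : u ∈ subdiff f x) :
    f x < ⊤ := by
  obtain ⟨y, hy⟩ := hdom
  by_contra h
  have h1 := hu y
  rw [not_lt_top_iff.1 h, EReal.coe_add_top] at h1
  exact absurd hy (not_lt.2 h1)

theorem gamma0_zero : Gamma0 (fun _ : E => (0 : EReal)) where
  ne_bot _ := EReal.zero_ne_bot
  dom_nonempty := ⟨0, EReal.zero_lt_top⟩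
  lsc := lowerSemicontinuous_const
  convex_epi := by
    have : {p : E × ℝ | (0 : EReal) ≤ (p.2 : EReal)} = Prod.snd ⁻¹' Set.Ici (0 : ℝ) := by
      ext p; simp
    rw [this]
    exact (convex_Ici 0).is_linear_preimage (LinearMap.snd ℝ E ℝ).isLinear

theorem eq_zero_of_mem_subdiff_zero {x u : E} (hu : u ∈ subdiff (fun _ : E => (0 : EReal)) x) :
    u = 0 := by
  have h := hu (x + u)
  simp only [add_sub_cancel_left, add_zero] at h
  exact real_inner_self_nonpos.1 (EReal.coe_nonpos.1 h)

theorem conj_ne_bot (hb : ∀ x, f x ≠ ⊥) (hdom : (effDom f).Nonempty) (u : E) :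
    conj f u ≠ ⊥ := by
  obtain ⟨x, hx⟩ := hdom
  obtain ⟨a, ha⟩ := exists_coe_eq_of_lt_top (hb x) hx
  have h : ((inner ℝ x u - a : ℝ) : EReal) ≤ conj f u := by
    refine le_iSup_of_le x ?_
    rw [ha, EReal.coe_sub]
  exact ne_bot_of_le_ne_bot (EReal.coe_ne_bot _) h

/-- The conjugate of a function in `Γ₀` is proper: there is a continuous affine minorant. -/
theorem Gamma0.effDom_conj_nonempty [CompleteSpace E] (hf : Gamma0 f) :
    (effDom (conj f)).Nonempty := by
  obtain ⟨x₀, hx₀⟩ := hf.dom_nonempty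
  obtain ⟨a, ha⟩ := exists_coe_eq_of_lt_top (hf.ne_bot x₀) hx₀
  -- Separating a point directly below the graph makes the vertical coefficient `c` positive, so the
  -- hyperplane is the graph of an affine minorant.
  have hnot : (x₀, a - 1) ∉ {p : E × ℝ | f p.1 ≤ (p.2 : EReal)} := by
    simp only [Set.mem_ofPred_eq, ha, EReal.coe_le_coe_iff]; linarith
  obtain ⟨F, β, h1, h2⟩ := geometric_hahn_banach_point_closed hf.convex_epi hf.isClosed_epi hnot
  let m : E →L[ℝ] ℝ := F.comp (ContinuousLinearMap.inl ℝ E ℝ)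
  let c : ℝ := F (0, 1)
  have hFd : ∀ y s, F (y, s) = m y + s * c := by
    intro y s
    have : ((y, s) : E × ℝ) = (y, 0) + s • ((0, 1) : E × ℝ) := by simp
    rw [this, map_add, map_smul, smul_eq_mul]
    rfl
  have hc : 0 < c := by
    have h3 := h2 (x₀, a) ha.le
    rw [hFd] at h1 h3
    linarith
  refine ⟨(-c⁻¹) • (InnerProductSpace.toDual ℝ E).symm m, ?_⟩
  refine lt_of_le_of_lt (iSup_le fun x => ?_) (EReal.coe_lt_top (-β / c))
  rw [real_inner_smul_right, real_inner_comm, InnerProductSpace.toDual_symm_apply]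
  rcases eq_or_ne (f x) ⊤ with h | h
  · rw [h, EReal.sub_top]
    exact bot_le
  · obtain ⟨b, hb⟩ := exists_coe_eq_of_lt_top (hf.ne_bot x) h.lt_top
    have h3 := h2 (x, b) hb.le
    rw [hFd] at h3
    rw [hb, ← EReal.coe_sub, EReal.coe_le_coe_iff, le_div_iff₀ hc]
    have : (-c⁻¹ * m x - b) * c = -(m x) - b * c := by field_simp
    rw [this]
    linarith

/-- Minimizers of `f - ⟨·, z⟩` are the points where `z` is a subgradient. -/
theorem mem_subdiff_of_mem_argmin (hb : ∀ x, f x ≠ ⊥) {x z : E}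
    (hx : x ∈ Argmin (fun x : E => f x - ((inner ℝ x z : ℝ) : EReal))) : z ∈ subdiff f x := by
  obtain ⟨hlt, hmin⟩ := hx
  have hft : f x < ⊤ := by
    refine lt_top_iff_ne_top.2 fun h => ?_
    simp only [h, EReal.top_sub_coe, lt_irrefl] at hlt
  obtain ⟨a, ha⟩ := exists_coe_eq_of_lt_top (hb x) hft
  intro y
  rcases eq_or_ne (f y) ⊤ with h | h
  · rw [h]; exact le_top
  · obtain ⟨s, hs⟩ := exists_coe_eq_of_lt_top (hb y) h.lt_top
    have h1 := hmin y
    simp only [ha, hs] at h1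
    rw [← EReal.coe_sub, ← EReal.coe_sub, EReal.coe_le_coe_iff] at h1
    rw [hs, ha, ← EReal.coe_add, EReal.coe_le_coe_iff, inner_sub_left]
    linarith

theorem zero_mem_subdiff_indicatorFn {C : Set E} {x : E} (hx : x ∈ C) :
    0 ∈ subdiff (indicatorFn C) x := by
  intro y
  simp only [inner_zero_right, EReal.coe_zero, zero_add, indicatorFn, if_pos hx]
  split_ifs
  · exact le_rfl
  · exact le_top

end Functions

/-! ### Fermat's rule and its converse under qualification -/

section Duality

variable {H G : Type*} [NormedAddCommGroup H] [InnerProductSpace ℝ H] [CompleteSpace H]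
  [NormedAddCommGroup G] [InnerProductSpace ℝ G] [CompleteSpace G]
  {f : H → EReal} {g : G → EReal}

/-- Fermat's rule: zeros of the primal inclusion are primal minimizers. -/
theorem zer_primal_subset_argmin (hf : Gamma0 f) (hg : Gamma0 g) (L : H →L[ℝ] G) (z : H)
    (r : G) :
    zer (fun x : H => {-z} + subdiff f x + L.adjoint '' subdiff g (L x - r)) ⊆
      Argmin (fun x : H => f x - ((inner ℝ x z : ℝ) : EReal) + g (L x - r)) := by
  rintro x ⟨_, ⟨_, rfl, u, hu, rfl⟩, _, ⟨v, hv, rfl⟩, h0⟩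
  obtain ⟨a, ha⟩ := exists_coe_eq_of_lt_top (hf.ne_bot x)
    (lt_top_of_mem_subdiff hf.dom_nonempty hu)
  obtain ⟨b, hb⟩ := exists_coe_eq_of_lt_top (hg.ne_bot (L x - r))
    (lt_top_of_mem_subdiff hg.dom_nonempty hv)
  have hz : z = u + L.adjoint v := by
    have : -z + u + L.adjoint v = 0 := h0
    rw [add_assoc] at this
    exact neg_add_eq_zero.1 this
  simp only [Argmin, Set.mem_ofPred_eq, ha, hb]
  refine ⟨by rw [← EReal.coe_sub, ← EReal.coe_add]; exact EReal.coe_lt_top _, fun y => ?_⟩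
  have h1 := hu y
  have h2 := hv (L y - r)
  rw [ha, ← EReal.coe_add] at h1
  rw [hb, ← EReal.coe_add] at h2
  calc (a : EReal) - ((inner ℝ x z : ℝ) : EReal) + b
      = ((inner ℝ (y - x) u + a : ℝ) : EReal) - ((inner ℝ y z : ℝ) : EReal) +
          ((inner ℝ (L y - r - (L x - r)) v + b : ℝ) : EReal) := by
        rw [← EReal.coe_sub, ← EReal.coe_sub, ← EReal.coe_add, ← EReal.coe_add,
          EReal.coe_eq_coe_iff, sub_sub_sub_cancel_right, ← map_sub,
          ← ContinuousLinearMap.adjoint_inner_right, hz]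
        simp only [inner_sub_left, inner_add_right]
        ring
    _ ≤ _ := add_le_add (EReal.sub_le_sub h1 le_rfl) h2

/-- Zeros of the dual inclusion are dual minimizers. -/
theorem zer_dual_subset_argmin (hf : Gamma0 f) (hg : Gamma0 g) (L : H →L[ℝ] G) (z : H)
    (r : G) :
    zer (fun v : G => {r} - L '' subdiff (conj f) (z - L.adjoint v) + subdiff (conj g) v) ⊆
      Argmin (fun v : G => conj f (z - L.adjoint v) + conj g v +
        ((inner ℝ r v : ℝ) : EReal)) := by
  rintro v ⟨_, ⟨r', hr', _, ⟨x, hx, rfl⟩, rfl⟩, w, hw, h0⟩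
  obtain rfl : r = r' := hr'.symm
  obtain ⟨a, ha⟩ := exists_coe_eq_of_lt_top (conj_ne_bot hf.ne_bot hf.dom_nonempty _)
    (lt_top_of_mem_subdiff hf.effDom_conj_nonempty hx)
  obtain ⟨b, hb⟩ := exists_coe_eq_of_lt_top (conj_ne_bot hg.ne_bot hg.dom_nonempty _)
    (lt_top_of_mem_subdiff hg.effDom_conj_nonempty hw)
  have hr : r = L x - w := by
    have : r - L x + w = 0 := h0
    rw [eq_sub_iff_add_eq, ← sub_eq_zero, ← this]
    abel
  simp only [Argmin, Set.mem_ofPred_eq, ha, hb]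
  refine ⟨by rw [← EReal.coe_add, ← EReal.coe_add]; exact EReal.coe_lt_top _, fun y => ?_⟩
  have h1 := hx (z - L.adjoint y)
  have h2 := hw y
  rw [ha, ← EReal.coe_add] at h1
  rw [hb, ← EReal.coe_add] at h2
  calc (a : EReal) + b + ((inner ℝ r v : ℝ) : EReal)
      = ((inner ℝ (z - L.adjoint y - (z - L.adjoint v)) x + a : ℝ) : EReal) +
          ((inner ℝ (y - v) w + b : ℝ) : EReal) + ((inner ℝ r y : ℝ) : EReal) := by
        rw [← EReal.coe_add, ← EReal.coe_add, ← EReal.coe_add, ← EReal.coe_add,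
          EReal.coe_eq_coe_iff, sub_sub_sub_cancel_left, ← map_sub,
          ContinuousLinearMap.adjoint_inner_left, hr, real_inner_comm v, real_inner_comm y]
        simp only [inner_sub_left, inner_sub_right]
        ring
    _ ≤ _ := add_le_add (add_le_add h1 h2) le_rfl

/-- Under the strong relative interior qualification, every primal minimizer solves the primal
inclusion. -/
theorem mem_subdiff_add_of_mem_argmin (hf : Gamma0 f) (hg : Gamma0 g) (L : H →L[ℝ] G) (z : H)
    (r : G) (hr : r ∈ sri (L '' effDom f - effDom g)) {x : H}
    (hx : x ∈ Argmin (fun x : H => f x + g (L x - r) - ((inner ℝ x z : ℝ) : EReal))) :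
    z ∈ subdiff f x + L.adjoint '' subdiff g (L x - r) := by
  obtain ⟨-, V, hVc, hV⟩ := hr
  obtain ⟨hlt, hmin⟩ := hx
  have hft : f x < ⊤ := by
    refine lt_top_iff_ne_top.2 fun h => ?_
    simp only [h, EReal.top_add_of_ne_bot (hg.ne_bot _), EReal.top_sub_coe, lt_irrefl] at hlt
  have hgt : g (L x - r) < ⊤ := by
    refine lt_top_iff_ne_top.2 fun h => ?_
    simp only [h, EReal.add_top_of_ne_bot (hf.ne_bot _), EReal.top_sub_coe, lt_irrefl] at hlt
  obtain ⟨a, ha⟩ := exists_coe_eq_of_lt_top (hf.ne_bot x) hft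
  obtain ⟨b, hb⟩ := exists_coe_eq_of_lt_top (hg.ne_bot _) hgt
  have : CompleteSpace V := hVc.completeSpace_coe
  -- On `E` the constraint map takes values in `V`, so `P` loses nothing there and makes the map
  -- absorbing in its codomain.
  let P : G →L[ℝ] V := V.orthogonalProjectionOnto
  let E : Set ((H × ℝ) × (G × ℝ)) :=
    {q | f (x + q.1.1) ≤ ((a + q.1.2 : ℝ) : EReal) ∧
      g (L x - r + q.2.1) ≤ ((b + q.2.2 : ℝ) : EReal)}
  let fs : (H × ℝ) × (G × ℝ) →L[ℝ] H × ℝ := ContinuousLinearMap.fst ℝ _ _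
  let sn : (H × ℝ) × (G × ℝ) →L[ℝ] G × ℝ := ContinuousLinearMap.snd ℝ _ _
  let T₀ : (H × ℝ) × (G × ℝ) →L[ℝ] G :=
    L ∘L ContinuousLinearMap.fst ℝ H ℝ ∘L fs - ContinuousLinearMap.fst ℝ G ℝ ∘L sn
  let φ : (H × ℝ) × (G × ℝ) →L[ℝ] ℝ :=
    ContinuousLinearMap.snd ℝ H ℝ ∘L fs + ContinuousLinearMap.snd ℝ G ℝ ∘L sn
      - innerSL ℝ z ∘L ContinuousLinearMap.fst ℝ H ℝ ∘L fs
  have hT₀ : ∀ q, T₀ q = L q.1.1 - q.2.1 := fun q => rfl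
  have hφ : ∀ q, φ q = q.1.2 + q.2.2 - inner ℝ z q.1.1 := fun q => rfl
  have hE : E = (fun q => ((x, a), (L x - r, b)) + q) ⁻¹'
      ({p : H × ℝ | f p.1 ≤ (p.2 : EReal)} ×ˢ {p : G × ℝ | g p.1 ≤ (p.2 : EReal)}) := rfl
  have hEc : IsClosed E := by
    rw [hE]
    exact (hf.isClosed_epi.prod hg.isClosed_epi).preimage (continuous_const.add continuous_id)
  have hEx : Convex ℝ E := by
    rw [hE]
    exact (hf.convex_epi.prod hg.convex_epi).translate_preimage_right _
  have hT₀V : ∀ q ∈ E, T₀ q ∈ V := by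
    intro q hq
    have : T₀ q ∈ (V : Set G) := by
      rw [← hV]
      refine ⟨1, one_pos, L (x + q.1.1) - (L x - r + q.2.1), ?_, ?_⟩
      · exact Set.sub_mem_sub ⟨_, hq.1.trans_lt (EReal.coe_lt_top _), rfl⟩
          (hq.2.trans_lt (EReal.coe_lt_top _))
      · rw [hT₀, one_smul, map_add]; abel
    exact this
  have hPT : ∀ q ∈ E, ((P (T₀ q) : V) : G) = T₀ q := fun q hq =>
    V.starProjection_eq_self_iff.2 (hT₀V q hq)
  have habs : ∀ y : V, ∃ t : ℝ, 0 < t ∧ ∃ e ∈ E, y = t • (P ∘L T₀) e := by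
    intro y
    have hy : (y : G) ∈ (V : Set G) := y.2
    rw [← hV] at hy
    obtain ⟨t, ht, _, ⟨_, ⟨x', hx', rfl⟩, w, hw, rfl⟩, hyt⟩ := hy
    obtain ⟨a', ha'⟩ := exists_coe_eq_of_lt_top (hf.ne_bot x') hx'
    obtain ⟨b', hb'⟩ := exists_coe_eq_of_lt_top (hg.ne_bot w) hw
    have he : ((x' - x, a' - a), (w - (L x - r), b' - b)) ∈ E := by
      simp only [E, Set.mem_ofPred_eq, add_sub_cancel, ha', hb', le_refl, and_self]
    refine ⟨t, ht, _, he, Subtype.ext ?_⟩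
    rw [V.coe_smul, ContinuousLinearMap.comp_apply, hPT _ he, hyt, hT₀, map_sub]
    congr 1
    change L x' - w - r = L x' - L x - (w - (L x - r))
    abel
  have hmin' : ∀ e ∈ E, (P ∘L T₀) e = 0 → 0 ≤ φ e := by
    intro e he h0
    have h1 : T₀ e = 0 := by rw [← hPT e he]; exact congrArg Subtype.val h0
    rw [hT₀, sub_eq_zero] at h1
    have h2 := (hmin (x + e.1.1)).trans (EReal.sub_le_sub (add_le_add he.1
      (show g (L (x + e.1.1) - r) ≤ ((b + e.2.2 : ℝ) : EReal) by
        rw [map_add, h1, add_sub_right_comm]; exact he.2)) le_rfl)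
    simp only [ha, hb] at h2
    rw [← EReal.coe_add, ← EReal.coe_add, ← EReal.coe_sub, ← EReal.coe_sub,
      EReal.coe_le_coe_iff, inner_add_left] at h2
    rw [hφ, real_inner_comm]
    linarith
  obtain ⟨l, hl⟩ := exists_multiplier_of_absorbing hEc hEx (P ∘L T₀) φ habs hmin'
  -- The Riesz representative of the multiplier, extended by zero on the orthogonal complement of
  -- `V`.
  let v : G := (InnerProductSpace.toDual ℝ G).symm (l ∘L P)
  have hv : ∀ e ∈ E, inner ℝ v (L e.1.1 - e.2.1) ≤ e.1.2 + e.2.2 - inner ℝ z e.1.1 := by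
    intro e he
    rw [InnerProductSpace.toDual_symm_apply]
    exact hl e he
  -- Freezing one block of `E` at the origin decouples the multiplier inequality into the two
  -- subgradient inequalities.
  refine ⟨z + L.adjoint v, fun y => ?_, L.adjoint (-v), ⟨-v, fun w => ?_, rfl⟩, ?_⟩
  · rcases eq_or_ne (f y) ⊤ with h | h
    · rw [h]; exact le_top
    · obtain ⟨s, hs⟩ := exists_coe_eq_of_lt_top (hf.ne_bot y) h.lt_top
      have := hv ((y - x, s - a), (0, 0)) (by
        simp only [E, Set.mem_ofPred_eq, add_sub_cancel, add_zero, hs, hb, le_refl, and_self])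
      rw [hs, ha, ← EReal.coe_add, EReal.coe_le_coe_iff, inner_add_right,
        ContinuousLinearMap.adjoint_inner_right, real_inner_comm z, real_inner_comm v]
      simp only [sub_zero, add_zero] at this
      linarith
  · rcases eq_or_ne (g w) ⊤ with h | h
    · rw [h]; exact le_top
    · obtain ⟨s, hs⟩ := exists_coe_eq_of_lt_top (hg.ne_bot w) h.lt_top
      have := hv ((0, 0), (w - (L x - r), s - b)) (by
        simp only [E, Set.mem_ofPred_eq, add_sub_cancel, add_zero, hs, ha, le_refl, and_self])
      rw [hs, hb, ← EReal.coe_add, EReal.coe_le_coe_iff, inner_neg_right, real_inner_comm v]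
      simp only [map_zero, zero_sub, inner_neg_right, inner_zero_right, sub_zero, zero_add]
        at this
      linarith
  · simp only [map_neg, add_neg_cancel_right]

end Duality

end ConvexHilbert

/-! ### The proposition -/

theorem proposition4p1
    {H G : Type*}
    [NormedAddCommGroup H] [InnerProductSpace ℝ H] [CompleteSpace H]
    [NormedAddCommGroup G] [InnerProductSpace ℝ G] [CompleteSpace G]
    (f : H → EReal) (hf : ConvexHilbert.Gamma0 f)
    (g : G → EReal) (hg : ConvexHilbert.Gamma0 g)
    (L : H →L[ℝ] G) (z : H) (r : G) :
    -- zeros of the primal inclusion are primal minimizers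
    (ConvexHilbert.zer (fun x : H => {-z} + ConvexHilbert.subdiff f x +
        L.adjoint '' ConvexHilbert.subdiff g (L x - r)) ⊆
      ConvexHilbert.Argmin
        (fun x : H => f x - ((inner ℝ x z : ℝ) : EReal) + g (L x - r))) ∧
    -- zeros of the dual inclusion are dual minimizers
    (ConvexHilbert.zer (fun v : G =>
        {r} - L '' ConvexHilbert.subdiff (ConvexHilbert.conj f) (z - L.adjoint v) +
          ConvexHilbert.subdiff (ConvexHilbert.conj g) v) ⊆
      ConvexHilbert.Argmin
        (fun v : G => ConvexHilbert.conj f (z - L.adjoint v) + ConvexHilbert.conj g v +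
          ((inner ℝ r v : ℝ) : EReal))) ∧
    -- each of the three qualification conditions gives solvability of the primal inclusion
    (((ConvexHilbert.Argmin
            (fun x : H => f x + g (L x - r) - ((inner ℝ x z : ℝ) : EReal))).Nonempty ∧
          r ∈ ConvexHilbert.sri
            (L '' ConvexHilbert.effDom f - ConvexHilbert.effDom g)) ∨
        (ConvexHilbert.Argmin
              (fun x : H => f x + g (L x - r) - ((inner ℝ x z : ℝ) : EReal)) ⊆
            ConvexHilbert.Argmin (fun x : H => f x - ((inner ℝ x z : ℝ) : EReal)) ∩
              ConvexHilbert.Argmin (fun x : H => g (L x - r)) ∧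
          (ConvexHilbert.Argmin (fun x : H => f x - ((inner ℝ x z : ℝ) : EReal)) ∩
              ConvexHilbert.Argmin (fun x : H => g (L x - r))).Nonempty ∧
          r ∈ ConvexHilbert.sri (Set.range L - ConvexHilbert.effDom g)) ∨
        (∃ (C : Set H) (D : Set G), IsClosed C ∧ Convex ℝ C ∧ IsClosed D ∧ Convex ℝ D ∧
          f = ConvexHilbert.indicatorFn C ∧ g = ConvexHilbert.indicatorFn D ∧ z = 0 ∧
          (C ∩ L ⁻¹' ({r} + D)).Nonempty ∧
          r ∈ ConvexHilbert.sri (Set.range L - D)) →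
      z ∈ ConvexHilbert.ran (fun x : H => ConvexHilbert.subdiff f x +
        L.adjoint '' ConvexHilbert.subdiff g (L x - r))) := by
  refine ⟨ConvexHilbert.zer_primal_subset_argmin hf hg L z r,
    ConvexHilbert.zer_dual_subset_argmin hf hg L z r, ?_⟩
  rintro (⟨⟨x, hx⟩, hr⟩ | ⟨-, ⟨x, hx1, hx2⟩, hr⟩ | ⟨C, D, -, -, -, -, rfl, rfl, rfl, h, -⟩)
  · exact ⟨x, ConvexHilbert.mem_subdiff_add_of_mem_argmin hf hg L z r hr hx⟩
  · have hdom : ConvexHilbert.effDom (fun _ : H => (0 : EReal)) = Set.univ :=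
      Set.eq_univ_of_forall fun _ => EReal.zero_lt_top
    -- With zero in place of `f` and of `z`, a minimizer of `g (L · - r)` yields `w` with `L.adjoint
    -- w = 0`; the vector `z` itself is then the subgradient of `f`.
    obtain ⟨u, hu, w, hw, huw⟩ := ConvexHilbert.mem_subdiff_add_of_mem_argmin
      ConvexHilbert.gamma0_zero hg L 0 r (by rwa [hdom, Set.image_univ]) (x := x) (by simpa using hx2)
    rw [ConvexHilbert.eq_zero_of_mem_subdiff_zero hu] at huw
    exact ⟨x, z, ConvexHilbert.mem_subdiff_of_mem_argmin hf.ne_bot hx1, w, hw, by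
      simp only [zero_add] at huw
      simp only [huw, add_zero]⟩
  · obtain ⟨x, hxC, _, rfl, d, hd, hxd⟩ := h
    -- At a feasible point both indicators attain their minimum, so `0` is a subgradient of each.
    refine ⟨x, 0, ConvexHilbert.zero_mem_subdiff_indicatorFn hxC, 0,
      ⟨0, ConvexHilbert.zero_mem_subdiff_indicatorFn ?_, map_zero _⟩, add_zero _⟩
    rw [← hxd]
    simpa using hd
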